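/- Let $S_3$ be the metric space consisting of three half-lines $b_1,b_2,b_3$, each a copy of $[0,\infty)$, glued at their common origin $O$: a point is a pair $(x,b_\ell)$ with $x\ge 0$ and $\ell\in\{1,2,3\}$ (the three pairs with $x=0$ being the same point $O$), and the distance $d$ between $(x,b_\ell)$ and $(x',b_{\ell'})$ is $|x-x'|$ if $\ell=\ell'$ and $x+x'$ otherwise. A deterministic mechanism for 2-Facility Location with 3 agents in $S_3$ is a function $F$ that maps every instance $\vec x=(x_1,x_2,x_3)\in S_3^3$ to a pair $F(\vec x)\in S_3^2$ of facility locations. For $a\in S_3$ and $\vec y=(y_1,y_2)\in S_3^2$ let $\mathrm{cost}(a,\vec y)=\min\{d(a,y_1),d(a,y_2)\}$. The mechanism $F$ is strategyproof if $\mathrm{cost}(x_i,F(\vec x))\le \mathrm{cost}(x_i,F(\vec x_{-i},y))$ for every instance $\vec x$, every agent $i$ and every $y\in S_3$, where $(\vec x_{-i},y)$ is $\vec x$ with $x_i$ replaced by $y$. It has approximation ratio $\rho\ge 1$ if $\sum_{i=1}^3\mathrm{cost}(x_i,F(\vec x))\le\rho\cdot\min_{\vec y\in S_3^2}\sum_{i=1}^3\mathrm{cost}(x_i,\vec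 y)$ for every instance $\vec x$. Theorem. Every deterministic strategyproof mechanism for 2-Facility Location with 3 agents in $S_3$ has an unbounded approximation ratio; that is, there is no real number $\rho\ge 1$ such that the mechanism has approximation ratio $\rho$. -/

import Mathlib

open scoped NNReal

namespace FacilityLocation

/-- Coordinates of a point of the star: the distance `radius` to the center and the half-line
`branch` on which the point lies. The three pairs of radius `0` all describe the center. -/
@[ext]
structure StarCoord where
  /-- distance to the center -/
  radius : ℝ≥0
  /-- one of the three half-lines -/
  branch : Fin 3

/-- Path distance in the star: `|x - x'|` on a common branch, `x + x'` on different branches. -/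
noncomputable instance : Dist StarCoord where
  dist p q :=
    if p.branch = q.branch then |(p.radius : ℝ) - (q.radius : ℝ)|
    else (p.radius : ℝ) + (q.radius : ℝ)

theorem StarCoord.dist_def (p q : StarCoord) :
    dist p q = if p.branch = q.branch then |(p.radius : ℝ) - (q.radius : ℝ)|
      else (p.radius : ℝ) + (q.radius : ℝ) := rfl

/-- On coordinates the path distance is a pseudometric (the center has three coordinates). -/
noncomputable instance : PseudoMetricSpace StarCoord where
  dist_self p := by simp [StarCoord.dist_def]
  dist_comm p q := by
    simp only [StarCoord.dist_def, eq_comm (a := p.branch), abs_sub_comm (p.radius : ℝ),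
      add_comm (p.radius : ℝ)]
  dist_triangle p q r := by
    have hp := p.radius.coe_nonneg
    have hq := q.radius.coe_nonneg
    have hr := r.radius.coe_nonneg
    simp only [StarCoord.dist_def]
    split_ifs <;> first | (exfalso; simp_all; done) | grind

/-- The star metric space `S₃`: three half-lines `[0, ∞)` glued at their common origin, that is,
the pairs (distance to the center, branch) with points at distance `0` identified. It carries the
metric induced by the path distance. -/
abbrev S3 : Type := SeparationQuotient StarCoord

/-- A deterministic mechanism for `K` facilities and `n` agents in `X`: it maps every profile of
reported locations to a `K`-tuple of facility locations. -/
abbrev Mechanism (n K : ℕ) (X : Type*) := (Fin n → X) → (Fin K → X)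

section

variable {X : Type*} [MetricSpace X] {n K : ℕ} [NeZero K]

/-- Cost of an agent at `a` for the facilities `y`: the distance to the nearest facility. -/
noncomputable def cost (a : X) (y : Fin K → X) : ℝ :=
  Finset.univ.inf' Finset.univ_nonempty fun l => dist a (y l)

/-- Social cost of the facilities `y` on the instance `x`: the sum of the agents' costs. -/
noncomputable def socialCost (x : Fin n → X) (y : Fin K → X) : ℝ :=
  ∑ i, cost (x i) y

variable (K) in
/-- Optimal social cost of an instance over all placements of `K` facilities. -/
noncomputable def optCost (x : Fin n → X) : ℝ :=
  ⨅ y : Fin K → X, socialCost x y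

/-- No agent can decrease her cost by misreporting her location. -/
def Strategyproof (F : Mechanism n K X) : Prop :=
  ∀ (x : Fin n → X) (i : Fin n) (y : X),
    cost (x i) (F x) ≤ cost (x i) (F (Function.update x i y))

/-- `F` has approximation ratio `ρ ≥ 1`: on every instance the social cost of its outcome is at
most `ρ` times the optimal one. -/
def HasApproxRatio (F : Mechanism n K X) (ρ : ℝ) : Prop :=
  1 ≤ ρ ∧ ∀ x : Fin n → X, socialCost x (F x) ≤ ρ * optCost K x

end

end FacilityLocation

/-! Pin one agent at radius `ζ` on branch `e`; the other two then face a two-agent mechanism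
(`IsNice`). If they lie off `e` and within `η = ζ / (ρ + 1)` of each other, the bounded ratio keeps
one facility for the pinned agent, so both use the other one. By strategyproofness, an agent who
reports a facility location she could obtain is served there at cost zero.

The core is `served_or_served`: off `e`, one fixed agent of the two is always served at her own
location. If the first agent fails somewhere, a gap in the set of locations she can obtain lets the
second win from the outer position on that branch (`exists_outer_served`). Continuity carries this
inward to the center and through it onto the other branch, where the second wins from the inner
position (`inner_served`). If the second fails too, the first wins from some outer position, which
is incompatible.

Finally, use pinned radii of scales `1`, `C`, `C ^ 2`. Suppose `l` is favoured when `k` is pinned,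
and `m` when `l` is pinned at a much smaller radius. With `m` at the center, `l` and `m` take both
facilities and `k` pays too much (`absurd_of_served`). Every pattern of favoured agents contains
such a chain. -/

namespace FacilityLocation

/-! ### Costs and two-agent mechanisms in a general metric space -/

section Cost

variable {X : Type*} [MetricSpace X]

theorem cost_le_dist (a : X) (y : Fin 2 → X) (l : Fin 2) : cost a y ≤ dist a (y l) :=
  Finset.inf'_le _ (Finset.mem_univ l)

theorem exists_cost_eq (a : X) (y : Fin 2 → X) : ∃ l, cost a y = dist a (y l) := by
  obtain ⟨l, -, h⟩ := Finset.exists_mem_eq_inf' (Finset.univ_nonempty (α := Fin 2))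
    fun l => dist a (y l)
  exact ⟨l, h⟩

theorem cost_nonneg (a : X) (y : Fin 2 → X) : 0 ≤ cost a y := by
  obtain ⟨l, h⟩ := exists_cost_eq a y
  exact h ▸ dist_nonneg

theorem cost_le_dist_add (a b : X) (y : Fin 2 → X) : cost a y ≤ dist a b + cost b y := by
  obtain ⟨l, h⟩ := exists_cost_eq b y
  rw [h]
  exact (cost_le_dist a y l).trans (dist_triangle _ _ _)

theorem cost_apply_self (y : Fin 2 → X) (l : Fin 2) : cost (y l) y = 0 :=
  le_antisymm ((cost_le_dist _ y l).trans_eq (dist_self _)) (cost_nonneg _ _)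

/-- If two distinct agents are served at their locations, a third agent far from both of them
pays too much. -/
theorem absurd_of_cost_eq_zero {p q s : X} {y : Fin 2 → X} {c : ℝ} (hp : cost p y = 0)
    (hq : cost q y = 0) (hpq : p ≠ q) (hsp : c < dist s p) (hsq : c < dist s q)
    (hs : cost s y ≤ c) : False := by
  obtain ⟨l, hl⟩ := exists_cost_eq p y
  obtain ⟨m, hm⟩ := exists_cost_eq q y
  obtain ⟨n, hn⟩ := exists_cost_eq s y
  have hl' : p = y l := dist_eq_zero.1 (hl ▸ hp)
  have hm' : q = y m := dist_eq_zero.1 (hm ▸ hq)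
  have hlm : l ≠ m := fun h => hpq (by rw [hl', hm', h])
  have : n = l ∨ n = m := by omega
  rcases this with rfl | rfl
  · rw [hl'] at hsp; linarith
  · rw [hm'] at hsq; linarith

/-- The outcomes `G a b` for two agents reporting `a` and `b` while the third agent stays at `z`:
neither of the two gains by misreporting, and the approximation ratio is `ρ`. -/
structure IsNice (ρ : ℝ) (z : X) (G : X → X → Fin 2 → X) : Prop where
  left : ∀ a a' b : X, cost a (G a b) ≤ cost a (G a' b)
  right : ∀ a b b' : X, cost b (G a b) ≤ cost b (G a b')
  ratio : ∀ (a b : X) (y : Fin 2 → X), cost z (G a b) + cost a (G a b) + cost b (G a b) ≤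
    ρ * (cost z y + cost a y + cost b y)
  one_le : 1 ≤ ρ

namespace IsNice

variable {ρ : ℝ} {z : X} {G : X → X → Fin 2 → X}

theorem swap (h : IsNice ρ z G) : IsNice ρ z fun a b => G b a where
  left a a' b := h.right b a a'
  right a b b' := h.left b b' a
  ratio a b y := by
    have := h.ratio b a y
    simp only [add_right_comm _ (cost a _)]
    exact this
  one_le := h.one_le

theorem cost_left_le_dist_add (h : IsNice ρ z G) (a a' b : X) :
    cost a (G a b) ≤ dist a a' + cost a' (G a' b) :=
  (h.left a a' b).trans (cost_le_dist_add _ _ _)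

/-- An agent at `G a b l` could report `a` and find a facility at her door. -/
theorem cost_left_apply (h : IsNice ρ z G) (a b : X) (l : Fin 2) :
    cost (G a b l) (G (G a b l) b) = 0 :=
  le_antisymm ((h.left _ a b).trans_eq (cost_apply_self _ l)) (cost_nonneg _ _)

theorem cost_self (h : IsNice ρ z G) (a : X) : cost a (G a a) = 0 := by
  have h1 := h.ratio a a ![z, a]
  have h2 : cost z ![z, a] = 0 := cost_apply_self ![z, a] 0
  have h3 : cost a ![z, a] = 0 := cost_apply_self ![z, a] 1
  rw [h2, h3] at h1
  have := cost_nonneg z (G a a)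
  have := cost_nonneg a (G a a)
  linarith

theorem cost_left_le_dist (h : IsNice ρ z G) (a b : X) : cost a (G a b) ≤ dist a b := by
  simpa [h.cost_self b] using h.cost_left_le_dist_add a b b

theorem cost_add_le (h : IsNice ρ z G) (a b : X) :
    cost z (G a b) + cost a (G a b) + cost b (G a b) ≤ ρ * dist a b := by
  have h1 := h.ratio a b ![z, a]
  have h2 : cost z ![z, a] = 0 := cost_apply_self ![z, a] 0
  have h3 : cost a ![z, a] = 0 := cost_apply_self ![z, a] 1
  have h4 : cost b ![z, a] ≤ dist a b := (cost_le_dist b ![z, a] 1).trans_eq (dist_comm _ _)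
  rw [h2, h3] at h1
  have := h.one_le
  nlinarith

/-- The bound is independent of `a`, so an agent far out on a branch is served by a facility on that
branch. -/
theorem cost_left_le (h : IsNice ρ z G) (a b : X) : cost a (G a b) ≤ ρ * dist z b := by
  have h1 := h.ratio a b ![a, b]
  have h2 : cost a ![a, b] = 0 := cost_apply_self ![a, b] 0
  have h3 : cost b ![a, b] = 0 := cost_apply_self ![a, b] 1
  have h4 : cost z ![a, b] ≤ dist z b := cost_le_dist z ![a, b] 1
  rw [h2, h3] at h1
  have := h.one_le
  have := cost_nonneg z (G a b)
  have := cost_nonneg b (G a b)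
  nlinarith

/-- Two agents close to each other compared with their distances from `z` are served by the same
facility. -/
theorem exists_common_facility (h : IsNice ρ z G) {a b : X} (ha : ρ * dist a b < dist z a)
    (hb : ρ * dist a b < dist z b) :
    ∃ l, cost a (G a b) = dist a (G a b l) ∧ cost b (G a b) = dist b (G a b l) := by
  obtain ⟨l, hl⟩ := exists_cost_eq a (G a b)
  obtain ⟨m, hm⟩ := exists_cost_eq b (G a b)
  obtain ⟨n, hn⟩ := exists_cost_eq z (G a b)
  have hs := h.cost_add_le a b
  have h1 := cost_nonneg a (G a b)
  have h2 := cost_nonneg b (G a b)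
  have hln : l ≠ n := by
    rintro rfl
    have := dist_triangle_right z a (G a b l)
    linarith
  have hmn : m ≠ n := by
    rintro rfl
    have := dist_triangle_right z b (G a b m)
    linarith
  obtain rfl : l = m := by omega
  exact ⟨l, hl, hm⟩

end IsNice

end Cost

/-! ### Two nearby agents on a segment -/

/-- The costs of two agents on a segment of length `L`, at `t` and `s` with `s ≤ t ≤ s + η`, when
both are served by one facility between them and neither of them gains by misreporting. -/
structure SegmentCosts (η L : ℝ) (A B : ℝ → ℝ → ℝ) : Prop where
  nonneg_ahead : ∀ t s, 0 ≤ A t s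
  nonneg_behind : ∀ t s, 0 ≤ B t s
  add_eq : ∀ t s, 0 ≤ s → s ≤ t → t ≤ L → t - s ≤ η → A t s + B t s = t - s
  zero_ahead : ∀ t s, 0 ≤ s → s ≤ t → t ≤ L → t - s ≤ η → A (t - A t s) s = 0
  zero_behind : ∀ t s, 0 ≤ s → s ≤ t → t ≤ L → t - s ≤ η → B t (t - A t s) = 0
  lipschitz_ahead : ∀ t t' s, 0 ≤ t → t ≤ L → 0 ≤ t' → t' ≤ L → A t s ≤ |t - t'| + A t' s
  lipschitz_behind : ∀ t s s', 0 ≤ s → s ≤ L → 0 ≤ s' → s' ≤ L → B t s ≤ |s - s'| + B t s'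

theorem continuousOn_of_le_abs_add {f : ℝ → ℝ} {a b : ℝ}
    (h : ∀ x y, a ≤ x → x ≤ b → a ≤ y → y ≤ b → f x ≤ |x - y| + f y) :
    ContinuousOn f (Set.Icc a b) := by
  refine LipschitzOnWith.continuousOn (K := 1) (LipschitzOnWith.of_le_add fun x hx y hy => ?_)
  have := h x y hx.1 hx.2 hy.1 hy.2
  rw [Real.dist_eq]
  linarith

namespace SegmentCosts

variable {η L : ℝ} {A B : ℝ → ℝ → ℝ}

/-- The shared facility stands at `t - A t s`, hence at `s` when `t = t₀`. The Lipschitz bound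
settles smaller `t`. For larger `t`, a location strictly between `s` and `t₀` would be a zero of `A`
already excluded, and a location beyond `t₀` would make the facility pass through `t₀` by
continuity, forcing `A t₀ s = 0`. -/
theorem ahead_eq (h : SegmentCosts η L A B) {s t₀ : ℝ} (hs : 0 ≤ s) (hst : s < t₀) (htL : t₀ ≤ L)
    (hη : t₀ - s ≤ η) (h₀ : A t₀ s = t₀ - s) {t : ℝ} (h1 : s ≤ t) (h2 : t ≤ L) (h3 : t - s ≤ η) :
    A t s = t - s := by
  have key : ∀ t, s ≤ t → t ≤ t₀ → A t s = t - s := by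
    intro t h1 h2
    have e1 := h.add_eq t s hs h1 (by linarith) (by linarith)
    have e2 := h.nonneg_behind t s
    have e3 := h.lipschitz_ahead t₀ t s (by linarith) htL (by linarith) (by linarith)
    rw [abs_of_nonneg (by linarith)] at e3
    linarith
  rcases le_total t t₀ with h4 | h4
  · exact key t h1 h4
  have e1 := h.add_eq t s hs h1 h2 h3
  have e2 := h.nonneg_behind t s
  by_contra hne
  have hlt : s < t - A t s := by
    rcases eq_or_lt_of_le e2 with h5 | h5
    · exact absurd (by linarith) hne
    · linarith
  rcases lt_or_ge (t - A t s) t₀ with h5 | h5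
  · have e3 := h.zero_ahead t s hs h1 h2 h3
    rw [key _ hlt.le h5.le] at e3
    linarith
  · have hc : ContinuousOn (fun x => x - A x s) (Set.Icc t₀ t) :=
      continuousOn_id.sub (continuousOn_of_le_abs_add fun x y hx hx' hy hy' =>
        h.lipschitz_ahead x y s (by linarith) (by linarith) (by linarith) (by linarith))
    obtain ⟨x, ⟨hx1, hx2⟩, hx⟩ := intermediate_value_Icc h4 hc (show t₀ ∈ Set.Icc _ _ from
      ⟨by simp only [h₀]; linarith, h5⟩)
    have e3 := h.zero_ahead x s hs (by linarith) (by linarith) (by linarith)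
    simp only at hx
    rw [hx] at e3
    linarith

/-- The facility location `x + B t x` moves continuously from `s` to at least `t`, so it hits `s'`.
-/
theorem behind_eq_zero_of_le (h : SegmentCosts η L A B) {s t : ℝ} (hs : 0 ≤ s) (htL : t ≤ L)
    (hη : t - s ≤ η) (h₀ : B t s = 0) {s' : ℝ} (h1 : s ≤ s') (h2 : s' ≤ t) : B t s' = 0 := by
  have hc : ContinuousOn (fun x => x + B t x) (Set.Icc s t) :=
    continuousOn_id.add (continuousOn_of_le_abs_add fun x y hx hx' hy hy' =>
      h.lipschitz_behind t x y (by linarith) (by linarith) (by linarith) (by linarith))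
  obtain ⟨x, ⟨hx1, hx2⟩, hx⟩ := intermediate_value_Icc (h1.trans h2) hc
    (show s' ∈ Set.Icc _ _ from ⟨by simp only [h₀]; linarith,
      by have := h.nonneg_behind t t; linarith⟩)
  have e1 := h.zero_behind t x (by linarith) hx2 htL (by linarith)
  have e2 := h.add_eq t x (by linarith) hx2 htL (by linarith)
  simp only at hx
  rwa [show t - A t x = s' by linarith] at e1

/-- If the agent behind is once served at her location, then so she is further ahead. -/
theorem behind_eq_zero (h : SegmentCosts η L A B) {s₀ t₀ : ℝ} (hs : 0 ≤ s₀) (hst : s₀ < t₀)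
    (htL : t₀ ≤ L) (hη : t₀ - s₀ ≤ η) (h₀ : B t₀ s₀ = 0) {s t : ℝ} (h1 : s₀ ≤ s) (h2 : s < t)
    (h3 : t ≤ L) (h4 : t - s ≤ η) : B t s = 0 := by
  have extend : ∀ s t₁, 0 ≤ s → s < t₁ → t₁ ≤ L → t₁ - s ≤ η → B t₁ s = 0 →
      ∀ t, s ≤ t → t ≤ L → t - s ≤ η → B t s = 0 := by
    intro s t₁ a1 a2 a3 a4 a5 t a6 a7 a8
    have e1 := h.add_eq t₁ s a1 a2.le a3 a4
    have e2 := h.ahead_eq a1 a2 a3 a4 (by linarith) a6 a7 a8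
    have e3 := h.add_eq t s a1 a6 a7 a8
    linarith
  have hη0 : 0 < η := by linarith
  -- Advance by `η / 2`: a partner `t₁` within `η` of the earlier point `s'` still lies beyond `s`,
  -- so service at `s'` transfers to `s` and then to every partner of `s`.
  have step : ∀ n : ℕ, ∀ s, s₀ ≤ s → s ≤ s₀ + n * (η / 2) → s < L →
      ∀ t, s ≤ t → t ≤ L → t - s ≤ η → B t s = 0 := by
    intro n
    induction n with
    | zero =>
      intro s a1 a2 a3
      obtain rfl : s = s₀ := by simp at a2; linarith
      exact extend s t₀ hs hst htL hη h₀
    | succ n ih =>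
      intro s a1 a2 a3
      push_cast at a2
      set s' := max s₀ (s - η / 2) with hs'
      have b1 : s₀ ≤ s' := le_max_left _ _
      have b2 : s - η / 2 ≤ s' := le_max_right _ _
      have b3 : s' ≤ s := max_le a1 (by linarith)
      have b4 : s' ≤ s₀ + n * (η / 2) := max_le (le_add_of_nonneg_right (by positivity)) (by linarith)
      set t₁ := min L (s' + η) with ht₁
      have c1 : t₁ ≤ L := min_le_left _ _
      have c2 : t₁ ≤ s' + η := min_le_right _ _
      have c3 : s < t₁ := lt_min a3 (by linarith)
      have d := ih s' b1 b4 (by linarith) t₁ (by linarith) c1 (by linarith)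
      exact extend s t₁ (by linarith) c3 c1 (by linarith)
        (h.behind_eq_zero_of_le (by linarith) c1 (by linarith) d b3 c3.le)
  obtain ⟨n, hn⟩ := exists_nat_ge ((s - s₀) / (η / 2))
  rw [div_le_iff₀ (by linarith)] at hn
  exact step n s h1 (by linarith) (by linarith) t h2.le h3 h4

end SegmentCosts

/-! ### Geometry of the star -/

/-- The point of the star on branch `b` at distance `r` from the center. -/
noncomputable def starPoint (b : Fin 3) (r : ℝ) : S3 :=
  SeparationQuotient.mk ⟨r.toNNReal, b⟩

theorem exists_eq_starPoint (y : S3) : ∃ b r, 0 ≤ r ∧ y = starPoint b r := by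
  obtain ⟨⟨r, b⟩, rfl⟩ := SeparationQuotient.surjective_mk y
  exact ⟨b, r, r.coe_nonneg, by simp [starPoint]⟩

theorem dist_starPoint_same (b : Fin 3) {r s : ℝ} (hr : 0 ≤ r) (hs : 0 ≤ s) :
    dist (starPoint b r) (starPoint b s) = |r - s| := by
  simp [starPoint, SeparationQuotient.dist_mk, StarCoord.dist_def, hr, hs]

theorem dist_starPoint_of_ne {b c : Fin 3} (hbc : b ≠ c) {r s : ℝ} (hr : 0 ≤ r) (hs : 0 ≤ s) :
    dist (starPoint b r) (starPoint c s) = r + s := by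
  simp [starPoint, SeparationQuotient.dist_mk, StarCoord.dist_def, hr, hs, hbc]

theorem starPoint_zero (b c : Fin 3) : starPoint b 0 = starPoint c 0 := by
  rcases eq_or_ne b c with rfl | h
  · rfl
  · rw [← dist_eq_zero, dist_starPoint_of_ne h le_rfl le_rfl, add_zero]

theorem exists_eq_starPoint_of_dist_le {b : Fin 3} {u v : ℝ} (hu : 0 ≤ u) (huv : u ≤ v) {y : S3}
    (h1 : dist (starPoint b u) y ≤ v - u) (h2 : dist (starPoint b v) y ≤ v - u) :
    ∃ r, u ≤ r ∧ r ≤ v ∧ y = starPoint b r := by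
  obtain ⟨c, r, hr, rfl⟩ := exists_eq_starPoint y
  rcases eq_or_ne b c with rfl | hbc
  · rw [dist_starPoint_same b hu hr, abs_le] at h1
    rw [dist_starPoint_same b (hu.trans huv) hr, abs_le] at h2
    exact ⟨r, by linarith, by linarith, rfl⟩
  · rw [dist_starPoint_of_ne hbc (hu.trans huv) hr] at h2
    obtain rfl : u = 0 := by linarith
    obtain rfl : r = 0 := by linarith
    exact ⟨0, le_rfl, huv, starPoint_zero _ _⟩

/-! ### One of two agents is favoured off the pinned branch -/

namespace IsNice

variable {ρ ζ η : ℝ} {e : Fin 3} {G : S3 → S3 → Fin 2 → S3}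

/-- The choice of `η` gives `ρ * η < ζ`, and every point off `e` is at distance at least `ζ` from
the pinned agent. -/
theorem exists_common_facility_star (h : IsNice ρ (starPoint e ζ) G) (hζ : 0 < ζ)
    (hη : η = ζ / (ρ + 1)) {b c : Fin 3} (hb : b ≠ e) (hc : c ≠ e) {u v : ℝ} (hu : 0 ≤ u)
    (hv : 0 ≤ v) (huv : dist (starPoint b u) (starPoint c v) ≤ η) :
    ∃ y, cost (starPoint b u) (G (starPoint b u) (starPoint c v)) = dist (starPoint b u) y ∧
      cost (starPoint c v) (G (starPoint b u) (starPoint c v)) = dist (starPoint c v) y ∧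
      cost y (G y (starPoint c v)) = 0 ∧ cost y (G (starPoint b u) y) = 0 := by
  have h1 := h.one_le
  have hlt : ρ * dist (starPoint b u) (starPoint c v) < ζ := by
    refine (mul_le_mul_of_nonneg_left huv (by linarith)).trans_lt ?_
    rw [hη, mul_div_assoc', div_lt_iff₀ (by linarith)]
    linarith
  obtain ⟨l, hl⟩ := h.exists_common_facility (a := starPoint b u) (b := starPoint c v)
    (by rw [dist_starPoint_of_ne hb.symm hζ.le hu]; linarith)
    (by rw [dist_starPoint_of_ne hc.symm hζ.le hv]; linarith)
  exact ⟨_, hl.1, hl.2, h.cost_left_apply _ _ l, h.swap.cost_left_apply _ _ l⟩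

theorem cost_right_le_dist {X : Type*} [MetricSpace X] {z : X} {G : X → X → Fin 2 → X}
    (h : IsNice ρ z G) (a b : X) : cost b (G a b) ≤ dist a b := by
  rw [dist_comm]
  exact h.swap.cost_left_le_dist b a

theorem exists_common_facility_branch (h : IsNice ρ (starPoint e ζ) G) (hζ : 0 < ζ)
    (hη : η = ζ / (ρ + 1)) {b : Fin 3} (hb : b ≠ e) {u v : ℝ} (hu : 0 ≤ u)
    (hv : 0 ≤ v) (huv : |u - v| ≤ η) :
    ∃ r, min u v ≤ r ∧ r ≤ max u v ∧
      cost (starPoint b u) (G (starPoint b u) (starPoint b v)) = |u - r| ∧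
      cost (starPoint b v) (G (starPoint b u) (starPoint b v)) = |v - r| ∧
      cost (starPoint b r) (G (starPoint b r) (starPoint b v)) = 0 ∧
      cost (starPoint b r) (G (starPoint b u) (starPoint b r)) = 0 := by
  have hd := dist_starPoint_same b hu hv
  obtain ⟨y, h1, h2, h3, h4⟩ := h.exists_common_facility_star hζ hη hb hb hu hv (hd.trans_le huv)
  have h5 := h.cost_left_le_dist (starPoint b u) (starPoint b v)
  have h6 := h.cost_right_le_dist (starPoint b u) (starPoint b v)
  rw [h1, hd] at h5
  rw [h2, hd] at h6
  have : ∃ r, min u v ≤ r ∧ r ≤ max u v ∧ y = starPoint b r := by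
    rcases le_total u v with huv' | huv'
    · rw [abs_sub_comm, abs_of_nonneg (by linarith)] at h5 h6
      rw [min_eq_left huv', max_eq_right huv']
      exact exists_eq_starPoint_of_dist_le hu huv' h5 h6
    · rw [abs_of_nonneg (by linarith)] at h5 h6
      rw [min_eq_right huv', max_eq_left huv']
      exact exists_eq_starPoint_of_dist_le hv huv' h6 h5
  obtain ⟨r, hr1, hr2, rfl⟩ := this
  have hr : 0 ≤ r := (le_min hu hv).trans hr1
  rw [dist_starPoint_same b hu hr] at h1
  rw [dist_starPoint_same b hv hr] at h2
  exact ⟨r, hr1, hr2, h1, h2, h3, h4⟩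

theorem segmentCosts_outward (h : IsNice ρ (starPoint e ζ) G) (hζ : 0 < ζ)
    (hη : η = ζ / (ρ + 1)) {b : Fin 3} (hb : b ≠ e) (L : ℝ) :
    SegmentCosts η L
      (fun t s => cost (starPoint b t) (G (starPoint b t) (starPoint b s)))
      (fun t s => cost (starPoint b s) (G (starPoint b t) (starPoint b s))) := by
  have key : ∀ t s, 0 ≤ s → s ≤ t → t - s ≤ η → ∃ r, s ≤ r ∧ r ≤ t ∧
      cost (starPoint b t) (G (starPoint b t) (starPoint b s)) = t - r ∧
      cost (starPoint b s) (G (starPoint b t) (starPoint b s)) = r - s ∧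
      cost (starPoint b r) (G (starPoint b r) (starPoint b s)) = 0 ∧
      cost (starPoint b r) (G (starPoint b t) (starPoint b r)) = 0 := by
    intro t s h1 h2 h3
    obtain ⟨r, r1, r2, r3, r4, r5⟩ := h.exists_common_facility_branch hζ hη hb (h1.trans h2) h1
      (by rwa [abs_of_nonneg (by linarith)])
    rw [min_eq_right h2] at r1
    rw [max_eq_left h2] at r2
    rw [abs_of_nonneg (by linarith)] at r3
    rw [abs_sub_comm, abs_of_nonneg (by linarith)] at r4
    exact ⟨r, r1, r2, r3, r4, r5⟩
  refine ⟨fun _ _ => cost_nonneg _ _, fun _ _ => cost_nonneg _ _, ?_, ?_, ?_, ?_, ?_⟩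
  · intro t s h1 h2 _ h4
    obtain ⟨r, r1, r2, r3, r4, r5, r6⟩ := key t s h1 h2 h4
    simp only [r3, r4]
    ring
  · intro t s h1 h2 _ h4
    obtain ⟨r, r1, r2, r3, r4, r5, r6⟩ := key t s h1 h2 h4
    simpa only [r3, sub_sub_cancel] using r5
  · intro t s h1 h2 _ h4
    obtain ⟨r, r1, r2, r3, r4, r5, r6⟩ := key t s h1 h2 h4
    simpa only [r3, sub_sub_cancel] using r6
  · intro t t' s h1 _ h3 _
    rw [← dist_starPoint_same b h1 h3]
    exact h.cost_left_le_dist_add _ _ _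
  · intro t s s' h1 _ h3 _
    rw [← dist_starPoint_same b h1 h3]
    exact h.swap.cost_left_le_dist_add _ _ _

/-- The reversal `t ↦ L - t` makes "ahead" mean closer to the center. -/
theorem segmentCosts_inward (h : IsNice ρ (starPoint e ζ) G) (hζ : 0 < ζ)
    (hη : η = ζ / (ρ + 1)) {b : Fin 3} (hb : b ≠ e) (L : ℝ) :
    SegmentCosts η L
      (fun t s => cost (starPoint b (L - t)) (G (starPoint b (L - t)) (starPoint b (L - s))))
      (fun t s => cost (starPoint b (L - s)) (G (starPoint b (L - t)) (starPoint b (L - s)))) := by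
  have key : ∀ t s, s ≤ t → t ≤ L → t - s ≤ η → ∃ r, s ≤ r ∧ r ≤ t ∧
      cost (starPoint b (L - t)) (G (starPoint b (L - t)) (starPoint b (L - s))) = t - r ∧
      cost (starPoint b (L - s)) (G (starPoint b (L - t)) (starPoint b (L - s))) = r - s ∧
      cost (starPoint b (L - r)) (G (starPoint b (L - r)) (starPoint b (L - s))) = 0 ∧
      cost (starPoint b (L - r)) (G (starPoint b (L - t)) (starPoint b (L - r))) = 0 := by
    intro t s h1 h2 h3
    obtain ⟨r, r1, r2, r3, r4, r5⟩ := h.exists_common_facility_branch hζ hη hb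
      (u := L - t) (v := L - s) (by linarith) (by linarith)
      (by rw [abs_sub_comm, abs_of_nonneg (by linarith)]; linarith)
    rw [min_eq_left (by linarith)] at r1
    rw [max_eq_right (by linarith)] at r2
    rw [abs_sub_comm, abs_of_nonneg (by linarith)] at r3
    rw [abs_of_nonneg (by linarith)] at r4
    refine ⟨L - r, by linarith, by linarith, by linarith, by linarith, ?_⟩
    rwa [sub_sub_cancel]
  refine ⟨fun _ _ => cost_nonneg _ _, fun _ _ => cost_nonneg _ _, ?_, ?_, ?_, ?_, ?_⟩
  · intro t s h1 h2 h3 h4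
    obtain ⟨r, r1, r2, r3, r4, r5, r6⟩ := key t s h2 h3 h4
    simp only [r3, r4]
    ring
  · intro t s h1 h2 h3 h4
    obtain ⟨r, r1, r2, r3, r4, r5, r6⟩ := key t s h2 h3 h4
    simpa only [r3, sub_sub_cancel t] using r5
  · intro t s h1 h2 h3 h4
    obtain ⟨r, r1, r2, r3, r4, r5, r6⟩ := key t s h2 h3 h4
    simpa only [r3, sub_sub_cancel t] using r6
  · intro t t' s _ h2 _ h4
    have : |t - t'| = dist (starPoint b (L - t)) (starPoint b (L - t')) := by
      rw [dist_starPoint_same b (by linarith) (by linarith), abs_sub_comm]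
      congr 1; ring
    rw [this]
    exact h.cost_left_le_dist_add _ _ _
  · intro t s s' _ h2 _ h4
    have : |s - s'| = dist (starPoint b (L - s)) (starPoint b (L - s')) := by
      rw [dist_starPoint_same b (by linarith) (by linarith), abs_sub_comm]
      congr 1; ring
    rw [this]
    exact h.swap.cost_left_le_dist_add _ _ _

/-- If the first agent is not served at some point of a branch, then further out on this branch
the second agent, when she is farther out than the first one and close to her, is served. -/
theorem exists_outer_served (h : IsNice ρ (starPoint e ζ) G) (hη : 0 < η) {b : Fin 3} {t₀ : ℝ}
    (ht₀ : 0 ≤ t₀) {y : S3} (hpos : cost (starPoint b t₀) (G (starPoint b t₀) y) ≠ 0) :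
    ∃ t r, 0 ≤ t ∧ t < r ∧ r - t ≤ η ∧
      cost (starPoint b r) (G (starPoint b t) (starPoint b r)) = 0 := by
  set g : ℝ → ℝ := fun t => cost (starPoint b t) (G (starPoint b t) y) with hg
  have hlip : ∀ t s, 0 ≤ t → 0 ≤ s → g t ≤ |t - s| + g s := fun t s h1 h2 => by
    rw [← dist_starPoint_same b h1 h2]
    exact h.cost_left_le_dist_add _ _ _
  have hfac : ∀ t, 0 ≤ t → g t < t → ∃ r l, 0 ≤ r ∧ g r = 0 ∧ |t - r| = g t ∧
      G (starPoint b t) y l = starPoint b r := by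
    intro t h1 h2
    obtain ⟨l, hl⟩ := exists_cost_eq (starPoint b t) (G (starPoint b t) y)
    obtain ⟨c, r, hr, hc⟩ := exists_eq_starPoint (G (starPoint b t) y l)
    have hz := h.cost_left_apply (starPoint b t) y l
    rw [hc] at hl hz
    rcases eq_or_ne b c with rfl | hbc
    · rw [dist_starPoint_same b h1 hr] at hl
      exact ⟨r, l, hr, hz, hl.symm, hc⟩
    · rw [dist_starPoint_of_ne hbc h1 hr] at hl
      change g t = _ at hl
      linarith
  have hg0 : ∀ t, 0 ≤ g t := fun t => cost_nonneg _ _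
  set Z : Set ℝ := {t | t₀ ≤ t ∧ g t = 0} with hZ
  -- Far out she pays at most `M`, so the facility serving her is a zero of `g` beyond `t₀`.
  have hne : Z.Nonempty := by
    set M := ρ * dist (starPoint e ζ) y
    have hM : 0 ≤ M := mul_nonneg (by linarith [h.one_le]) dist_nonneg
    have hle : g (t₀ + M + 1) ≤ M := h.cost_left_le _ _
    obtain ⟨r, l, hr, hr0, habs, -⟩ := hfac (t₀ + M + 1) (by linarith) (by linarith)
    have := (abs_le.1 (habs.trans_le hle)).2
    exact ⟨r, by linarith, hr0⟩
  have hbdd : BddBelow Z := ⟨t₀, fun t ht => ht.1⟩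
  set r := sInf Z with hr
  have hr1 : t₀ ≤ r := le_csInf hne fun t ht => ht.1
  have hr0 : g r = 0 := by
    refine le_antisymm (le_of_forall_pos_le_add fun ε hε => ?_) (hg0 r)
    obtain ⟨t, ht, htr⟩ := exists_lt_of_csInf_lt hne (show sInf Z < r + ε by linarith)
    have h1 : r ≤ t := csInf_le hbdd ht
    have h2 := hlip r t (by linarith) (by linarith)
    rw [ht.2, abs_sub_comm, abs_of_nonneg (by linarith)] at h2
    linarith
  have hr2 : t₀ < r := lt_of_le_of_ne hr1 fun h0 => hpos (by rw [h0]; exact hr0)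
  -- From this `t`, the facility serving her is within `r - t`, hence beyond `t₀` and at most `r`.
  -- Being a zero of `g`, it must be `r`, the first one; so the second agent, reporting `y`, obtains
  -- a facility at `r`.
  set t := max (r - η) ((t₀ + 2 * r) / 3) with ht
  have ht1 : r - η ≤ t := le_max_left _ _
  have ht2 : (t₀ + 2 * r) / 3 ≤ t := le_max_right _ _
  have ht3 : t < r := max_lt (by linarith) (by linarith)
  have ht4 := hlip t r (by linarith) (by linarith)
  rw [hr0, abs_sub_comm, abs_of_nonneg (by linarith)] at ht4
  obtain ⟨r', l, hr', hr'0, habs, hl⟩ := hfac t (by linarith) (by linarith)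
  have h5 := abs_le.1 (habs.trans_le ht4)
  have h6 : r ≤ r' := csInf_le hbdd ⟨by linarith, hr'0⟩
  have h7 : r' = r := by linarith
  rw [h7] at hl
  refine ⟨t, r, by linarith, ht3, by linarith, ?_⟩
  have := h.swap.cost_left_apply y (starPoint b t) l
  simp only [hl] at this
  exact this

/-- If the second agent is served on branch `b` when she is somewhat farther out than the first
one, then she is served on branch `c` when she is somewhat closer to the center. -/
theorem inner_served (h : IsNice ρ (starPoint e ζ) G) (hζ : 0 < ζ) (hη : η = ζ / (ρ + 1))
    {b c : Fin 3} (hb : b ≠ e) (hc : c ≠ e) (hbc : b ≠ c) {t r : ℝ} (ht : 0 ≤ t) (htr : t < r)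
    (hrη : r - t ≤ η) (h₀ : cost (starPoint b r) (G (starPoint b t) (starPoint b r)) = 0)
    {s u : ℝ} (hs : 0 ≤ s) (hsu : s < u) (huη : u - s ≤ η) :
    cost (starPoint c s) (G (starPoint c u) (starPoint c s)) = 0 := by
  have hη0 : 0 < η := by linarith
  have hin : ∀ v, 0 < v → v ≤ r → v ≤ η →
      cost (starPoint b v) (G (starPoint b 0) (starPoint b v)) = 0 := by
    intro v h1 h2 h3
    have := (h.segmentCosts_inward hζ hη hb r).behind_eq_zero (s₀ := 0) (t₀ := r - t) le_rfl
      (by linarith) (by linarith) (by linarith) (by simpa using h₀) (s := r - v) (t := r)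
      (by linarith) (by linarith) le_rfl (by linarith)
    simpa using this
  obtain ⟨v, hv0, hvr, hvη⟩ : ∃ v, 0 < v ∧ v ≤ r ∧ v ≤ η / 2 :=
    ⟨min r (η / 2), lt_min (by linarith) (by linarith), min_le_left _ _, min_le_right _ _⟩
  have hv := hin v hv0 hvr (by linarith)
  set w := v / 2 with hw
  have hw0 : 0 < w := by positivity
  -- the first agent at radius `w` on `c`, the second one at radius `v` on `b`
  have hfar : cost (starPoint b v) (G (starPoint c w) (starPoint b v)) = 0 := by
    have hd := dist_starPoint_of_ne hbc.symm hw0.le hv0.le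
    obtain ⟨y, h1, h2, h3, -⟩ := h.exists_common_facility_star hζ hη hc hb hw0.le hv0.le
      (by rw [hd]; linarith)
    have h4 := h.cost_left_le_dist (starPoint c w) (starPoint b v)
    have h5 := h.cost_right_le_dist (starPoint c w) (starPoint b v)
    obtain ⟨k, -, -, k3, k4, -⟩ := h.exists_common_facility_branch hζ hη hb le_rfl hv0.le
      (by rw [zero_sub, abs_neg, abs_of_pos hv0]; linarith)
    have hk : v = k := by
      rw [hv] at k4
      exact sub_eq_zero.1 (abs_eq_zero.1 k4.symm)
    rw [← hk, zero_sub, abs_neg, abs_of_pos hv0] at k3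
    obtain ⟨d, x, hx, rfl⟩ := exists_eq_starPoint y
    -- With the second agent at `v`, the first pays `v` at the center; as she could report `y`
    -- instead, `y` has radius at least `v`.
    have h6 := h.cost_left_le_dist_add (starPoint b 0) (starPoint d x) (starPoint b v)
    rw [h3, k3, starPoint_zero b d, dist_starPoint_same d le_rfl hx, zero_sub, abs_neg,
      abs_of_nonneg hx] at h6
    rcases eq_or_ne b d with rfl | hbd
    · rw [h1, hd, dist_starPoint_of_ne hbc.symm hw0.le hx] at h4
      obtain rfl : x = v := by linarith
      rw [h2, dist_self]
    · rw [h2, hd, dist_starPoint_of_ne hbd hv0.le hx] at h5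
      linarith
  have hcenter : cost (starPoint c 0) (G (starPoint c w) (starPoint c 0)) = 0 := by
    set g : ℝ → ℝ := fun x => cost (starPoint b x) (G (starPoint c w) (starPoint b x)) with hg
    have hlip : ∀ x x', 0 ≤ x → 0 ≤ x' → g x ≤ |x - x'| + g x' := fun x x' h1 h2 => by
      rw [← dist_starPoint_same b h1 h2]
      exact h.swap.cost_left_le_dist_add _ _ _
    rw [starPoint_zero c b]
    change g 0 = 0
    -- Otherwise the facility location `x - g x` takes a value `τ < g 0` on `b`; then `g τ = 0`, and
    -- from the center reporting `τ` costs only `τ`.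
    by_contra hne
    have hpos : 0 < g 0 := lt_of_le_of_ne (cost_nonneg _ _) (Ne.symm hne)
    have hcont : ContinuousOn (fun x => x - g x) (Set.Icc 0 v) :=
      continuousOn_id.sub (continuousOn_of_le_abs_add fun x y hx _ hy _ => hlip x y hx hy)
    obtain ⟨τ, hτ0, hτv, hτg⟩ : ∃ τ, 0 < τ ∧ τ ≤ v ∧ τ < g 0 :=
      ⟨min v (g 0 / 2), lt_min hv0 (by linarith), min_le_left _ _,
        (min_le_right _ _).trans_lt (by linarith)⟩
    have hgv : g v = 0 := hfar
    obtain ⟨x, ⟨hx0, hxv⟩, hx⟩ := intermediate_value_Icc hv0.le hcont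
      (show τ ∈ Set.Icc _ _ from ⟨by linarith, by simp only [hgv]; linarith⟩)
    simp only at hx
    have hd := dist_starPoint_of_ne hbc.symm hw0.le hx0
    obtain ⟨y, h1, h2, -, h4⟩ := h.exists_common_facility_star hζ hη hc hb hw0.le hx0
      (by rw [hd]; linarith)
    have h5 := h.cost_left_le_dist (starPoint c w) (starPoint b x)
    obtain ⟨d, q, hq, rfl⟩ := exists_eq_starPoint y
    change g x = _ at h2
    rcases eq_or_ne b d with rfl | hbd
    · rw [h1, hd, dist_starPoint_of_ne hbc.symm hw0.le hq] at h5
      rw [dist_starPoint_same b hx0 hq, abs_of_nonneg (by linarith)] at h2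
      obtain rfl : q = τ := by linarith
      have h6 := hlip 0 q le_rfl hq
      change g q = 0 at h4
      rw [h4, zero_sub, abs_neg, abs_of_nonneg hq] at h6
      linarith
    · rw [dist_starPoint_of_ne hbd hx0 hq] at h2
      linarith
  exact (h.segmentCosts_outward hζ hη hc (max u w)).behind_eq_zero (s₀ := 0) (t₀ := w) le_rfl
    hw0 (le_max_right _ _) (by linarith) hcenter hs hsu (le_max_left _ _) huη

/-- While the third agent stays on branch `e`, one of the two other agents is served whenever she
is outside this branch. -/
theorem served_or_served (h : IsNice ρ (starPoint e ζ) G) (hζ : 0 < ζ) :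
    (∀ b ≠ e, ∀ r, 0 ≤ r → ∀ y, cost (starPoint b r) (G (starPoint b r) y) = 0) ∨
      ∀ b ≠ e, ∀ r, 0 ≤ r → ∀ y, cost (starPoint b r) (G y (starPoint b r)) = 0 := by
  obtain ⟨η, hη⟩ : ∃ η, η = ζ / (ρ + 1) := ⟨_, rfl⟩
  have hη0 : 0 < η := hη ▸ div_pos hζ (by linarith [h.one_le])
  by_contra! hcon
  obtain ⟨⟨b, hb, t₀, ht₀, y, hy⟩, b', hb', t₁, ht₁, y', hy'⟩ := hcon
  have hinner : ∀ c ≠ e, ∀ s u, 0 ≤ s → s < u → u - s ≤ η →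
      cost (starPoint c s) (G (starPoint c u) (starPoint c s)) = 0 := by
    intro c hc s u hs hsu hu
    obtain ⟨t, r, ht, htr, hrη, hr⟩ := h.exists_outer_served hη0 ht₀ hy
    rcases ne_or_eq b c with hbc | rfl
    · exact h.inner_served hζ hη hb hc hbc ht htr hrη hr hs hsu hu
    -- To come back to `b`, cross to `d`: the second agent's inner win there leaves the first
    -- unserved, which yields an outer win on `d` to send back through the center.
    · obtain ⟨d, hd, hbd⟩ : ∃ d : Fin 3, d ≠ e ∧ b ≠ d :=
        (by decide : ∀ e b : Fin 3, ∃ d, d ≠ e ∧ b ≠ d) e b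
      have h1 := h.inner_served hζ hη hb hd hbd ht htr hrη hr le_rfl hη0 (by linarith)
      obtain ⟨p, -, -, p1, p2, -⟩ := h.exists_common_facility_branch hζ hη hd hη0.le le_rfl
        (by rw [sub_zero, abs_of_pos hη0])
      have hp : 0 = p := by
        rw [h1] at p2
        exact sub_eq_zero.1 (abs_eq_zero.1 p2.symm)
      rw [← hp, sub_zero, abs_of_pos hη0] at p1
      obtain ⟨t', r', ht', htr', hrη', hr'⟩ := h.exists_outer_served hη0 hη0.le
        (by rw [p1]; exact hη0.ne')
      exact h.inner_served hζ hη hd hc hbd.symm ht' htr' hrη' hr' hs hsu hu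
  obtain ⟨t, r, ht, htr, hrη, hr⟩ := h.swap.exists_outer_served hη0 ht₁ hy'
  have h1 := hinner b' hb' t r ht htr hrη
  obtain ⟨p, -, -, p1, p2, -⟩ := h.exists_common_facility_branch hζ hη hb' (ht.trans htr.le) ht
    (by rwa [abs_of_pos (by linarith)])
  rw [hr] at p1
  rw [h1] at p2
  have e1 := sub_eq_zero.1 (abs_eq_zero.1 p1.symm)
  have e2 := sub_eq_zero.1 (abs_eq_zero.1 p2.symm)
  linarith

end IsNice

/-! ### Pinning each agent in turn -/

section Mechanism

variable {X : Type*} [MetricSpace X] {F : Mechanism 3 2 X} {ρ : ℝ}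

theorem HasApproxRatio.socialCost_le (hρ : HasApproxRatio F ρ) (x : Fin 3 → X) (y : Fin 2 → X) :
    socialCost x (F x) ≤ ρ * socialCost x y := by
  refine (hρ.2 x).trans (mul_le_mul_of_nonneg_left (ciInf_le ⟨0, ?_⟩ y) (by linarith [hρ.1]))
  rintro _ ⟨y, rfl⟩
  exact Finset.sum_nonneg fun i _ => cost_nonneg _ _

theorem socialCost_three (a b c : X) (y : Fin 2 → X) :
    socialCost ![a, b, c] y = cost a y + cost b y + cost c y := by
  simp [socialCost, Fin.sum_univ_three]

theorem isNice_zero (hF : Strategyproof F) (hρ : HasApproxRatio F ρ) (z : X) :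
    IsNice ρ z fun a b => F ![z, a, b] where
  left a a' b := by
    have h := hF ![z, a, b] 1 a'
    rw [show Function.update ![z, a, b] 1 a' = ![z, a', b] by
      ext t; fin_cases t <;> rfl] at h
    exact h
  right a b b' := by
    have h := hF ![z, a, b] 2 b'
    rw [show Function.update ![z, a, b] 2 b' = ![z, a, b'] by
      ext t; fin_cases t <;> rfl] at h
    exact h
  ratio a b y := by simpa only [socialCost_three] using hρ.socialCost_le ![z, a, b] y
  one_le := hρ.1

theorem isNice_one (hF : Strategyproof F) (hρ : HasApproxRatio F ρ) (z : X) :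
    IsNice ρ z fun a b => F ![a, z, b] where
  left a a' b := by
    have h := hF ![a, z, b] 0 a'
    rw [show Function.update ![a, z, b] 0 a' = ![a', z, b] by
      ext t; fin_cases t <;> rfl] at h
    exact h
  right a b b' := by
    have h := hF ![a, z, b] 2 b'
    rw [show Function.update ![a, z, b] 2 b' = ![a, z, b'] by
      ext t; fin_cases t <;> rfl] at h
    exact h
  ratio a b y := by
    have := hρ.socialCost_le ![a, z, b] y
    simp only [socialCost_three] at this
    linarith
  one_le := hρ.1

theorem isNice_two (hF : Strategyproof F) (hρ : HasApproxRatio F ρ) (z : X) :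
    IsNice ρ z fun a b => F ![a, b, z] where
  left a a' b := by
    have h := hF ![a, b, z] 0 a'
    rw [show Function.update ![a, b, z] 0 a' = ![a', b, z] by
      ext t; fin_cases t <;> rfl] at h
    exact h
  right a b b' := by
    have h := hF ![a, b, z] 1 b'
    rw [show Function.update ![a, b, z] 1 b' = ![a, b', z] by
      ext t; fin_cases t <;> rfl] at h
    exact h
  ratio a b y := by
    have := hρ.socialCost_le ![a, b, z] y
    simp only [socialCost_three] at this
    linarith
  one_le := hρ.1

/-- Two agents at distance less than `R / ρ`, one of them at the center, cannot both be served if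
the third agent is at distance `R` from the center, on another branch. -/
theorem IsNice.absurd_of_served {G : S3 → S3 → Fin 2 → S3} {b c : Fin 3} (hbc : b ≠ c) {r R : ℝ}
    (h : IsNice ρ (starPoint c R) G) (hr : 0 < r) (hR : ρ * r < R)
    (h0 : cost (starPoint c 0) (G (starPoint c 0) (starPoint b r)) = 0)
    (hq : cost (starPoint b r) (G (starPoint c 0) (starPoint b r)) = 0) : False := by
  have hR0 : 0 < R := (mul_pos (by linarith [h.one_le]) hr).trans hR
  have h1 := h.cost_add_le (starPoint c 0) (starPoint b r)
  have hd : dist (starPoint c 0) (starPoint b r) = r := by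
    rw [dist_starPoint_of_ne hbc.symm le_rfl hr.le, zero_add]
  rw [h0, hq, hd, add_zero, add_zero] at h1
  refine absurd_of_cost_eq_zero h0 hq (dist_pos.1 (by rwa [hd])) ?_ ?_ h1
  · rwa [dist_starPoint_same c hR0.le le_rfl, sub_zero, abs_of_pos hR0]
  · rw [dist_starPoint_of_ne hbc.symm hR0.le hr.le]
    linarith

end Mechanism

end FacilityLocation

theorem theorem5 (F : FacilityLocation.Mechanism 3 2 FacilityLocation.S3)
    (hF : FacilityLocation.Strategyproof F) :
    ¬ ∃ ρ : ℝ, FacilityLocation.HasApproxRatio F ρ := by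
  open FacilityLocation in
  rintro ⟨ρ, hρ⟩
  have h1 := hρ.1
  -- Successive scales `1`, `C`, `C ^ 2` differ by a factor larger than `ρ`.
  obtain ⟨C, hC⟩ : ∃ C, C = ρ + 1 := ⟨_, rfl⟩
  have hC0 : 0 < C := by linarith
  have hC1 : ρ * 1 < C := by linarith
  have hC2 : ρ * C < C ^ 2 := by nlinarith
  have hC3 : ρ * 1 < C ^ 2 := by nlinarith
  have hCC : 0 < C ^ 2 := by positivity
  rcases (isNice_two hF hρ (starPoint 0 C)).served_or_served hC0 with hA | hA
  · rcases (isNice_one hF hρ (starPoint 1 (C ^ 2))).served_or_served hCC with hB | hB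
    · rcases (isNice_zero hF hρ (starPoint 2 1)).served_or_served one_pos with hD | hD
      · exact (isNice_two hF hρ (starPoint 0 C)).swap.absurd_of_served (b := 2) (by decide)
          one_pos hC1 (hD 0 (by decide) 0 le_rfl _) (hA 2 (by decide) 1 zero_le_one _)
      · exact (isNice_one hF hρ (starPoint 1 (C ^ 2))).swap.absurd_of_served (b := 2) (by decide)
          one_pos hC3 (hD 1 (by decide) 0 le_rfl _) (hB 2 (by decide) 1 zero_le_one _)
    · exact (isNice_one hF hρ (starPoint 1 (C ^ 2))).absurd_of_served (b := 0) (by decide)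
        hC0 hC2 (hA 1 (by decide) 0 le_rfl _) (hB 0 (by decide) C hC0.le _)
  · rcases (isNice_zero hF hρ (starPoint 1 (C ^ 2))).served_or_served hCC with hB | hB
    · rcases (isNice_one hF hρ (starPoint 2 1)).served_or_served one_pos with hD | hD
      · exact (isNice_two hF hρ (starPoint 0 C)).absurd_of_served (b := 2) (by decide)
          one_pos hC1 (hD 0 (by decide) 0 le_rfl _) (hA 2 (by decide) 1 zero_le_one _)
      · exact (isNice_zero hF hρ (starPoint 1 (C ^ 2))).swap.absurd_of_served (b := 2) (by decide)
          one_pos hC3 (hD 1 (by decide) 0 le_rfl _) (hB 2 (by decide) 1 zero_le_one _)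
    · exact (isNice_zero hF hρ (starPoint 1 (C ^ 2))).absurd_of_served (b := 0) (by decide)
        hC0 hC2 (hA 1 (by decide) 0 le_rfl _) (hB 0 (by decide) C hC0.le _)
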